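/- Let $\eta,\mu$ be probability measures on $\mathbb{R}^d$ and let $\mathcal{K}_0(x,dy)$ be a Markov transition from $\mathbb{R}^d$ into itself. Set $\mathcal{P}_0(d(x,y)):=\eta(dx)\,\mathcal{K}_0(x,dy)$. Let $(\mathcal{K}_n)_{n\ge 1}$ be Markov transitions defined sequentially by the Sinkhorn conditioning formulae: for all $n\ge 0$, $$\pi_{2n}(dy)\,\mathcal{K}_{2n+1}(y,dx)=\eta(dx)\,\mathcal{K}_{2n}(x,dy),\qquad \pi_{2n+1}(dx)\,\mathcal{K}_{2n+2}(x,dy)=\mu(dy)\,\mathcal{K}_{2n+1}(y,dx),$$ where $$\pi_{2n}:=\eta\,\mathcal{K}_{2n}=\int\eta(dx)\,\mathcal{K}_{2n}(x,\cdot),\qquad \pi_{2n+1}:=\mu\,\mathcal{K}_{2n+1}=\int\mu(dy)\,\mathcal{K}_{2n+1}(y,\cdot).$$ Let $\mathcal{C}(\eta,\mu)$ be the set of probability measures on $\mathbb{R}^d\times\mathbb{R}^d$ with first marginal $\eta$ and second marginal $\mu$, and let $\mathrm{Ent}(\nu_1\,|\,\nu_2):=\int\log\frac{d\nu_1}{d\nu_2}\,d\nu_1\in[0,\infty]$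 be the relative entropy of probability measures, equal to $\infty$ when $\nu_1\not\ll\nu_2$. Let $\mathcal{P}\in\mathcal{C}(\eta,\mu)$ be such that $\mathrm{Ent}(\mathcal{P}\,|\,\mathcal{P}_0)<\infty$. Then for every $n\ge 1$, $$\max\bigl(\mathrm{Ent}(\mu\,|\,\pi_{2n}),\ \mathrm{Ent}(\eta\,|\,\pi_{2n+1})\bigr)\ \le\ \frac1n\,\mathrm{Ent}(\mathcal{P}\,|\,\mathcal{P}_0),$$ and, in addition, $$\lim_{n\to\infty} n\,\mathrm{Ent}(\mu\,|\,\pi_{2n})=\lim_{n\to\infty} n\,\mathrm{Ent}(\eta\,|\,\pi_{2n+1})=0.$$ -/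

import Mathlib

open MeasureTheory ProbabilityTheory InformationTheory Filter Topology
open scoped ENNReal

noncomputable section

/-- The marginal laws of the Sinkhorn iterates: `π_n = η K_n` for even `n` and `π_n = μ K_n` for
odd `n`. -/
def sinkhornMarginal {E : Type*} [MeasurableSpace E] (η μ : Measure E) (K : ℕ → Kernel E E)
    (n : ℕ) : Measure E :=
  if Even n then η.bind (K n) else μ.bind (K n)

/-- `K` is a sequence of Sinkhorn transitions for the target marginals `η` and `μ`, started at the
reference transition `K 0`. Here `K (2n)` acts from the `x`-coordinate to the `y`-coordinate and
`K (2n+1)` from the `y`-coordinate to the `x`-coordinate, `μ ⊗ₘ κ` is the measure `μ(dx) κ(x, dy)`,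
and the image under `Prod.swap` exchanges the two coordinates. Each transition is a conditional
distribution under the preceding iterate, any version of it being allowed. -/
structure IsSinkhorn {E : Type*} [MeasurableSpace E] (η μ : Measure E) (K : ℕ → Kernel E E) :
    Prop where
  markov : ∀ n, IsMarkovKernel (K n)
  odd_step : ∀ n,
    (sinkhornMarginal η μ K (2 * n) ⊗ₘ K (2 * n + 1)).map Prod.swap = η ⊗ₘ K (2 * n)
  even_step : ∀ n,
    sinkhornMarginal η μ K (2 * n + 1) ⊗ₘ K (2 * (n + 1)) = (μ ⊗ₘ K (2 * n + 1)).map Prod.swap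

/-- Sinkhorn transitions exist for every choice of marginals and of reference transition. -/
theorem IsSinkhorn.exists_of_start {E : Type*} [MeasurableSpace E] [StandardBorelSpace E]
    [Nonempty E] (η μ : Measure E) [IsProbabilityMeasure η] [IsProbabilityMeasure μ]
    (K₀ : Kernel E E) [IsMarkovKernel K₀] :
    ∃ K : ℕ → Kernel E E, K 0 = K₀ ∧ IsSinkhorn η μ K := by
  have step : ∀ (ρ : Measure E) [IsProbabilityMeasure ρ] (k : Kernel E E), IsMarkovKernel k →
      ∃ k' : Kernel E E, IsMarkovKernel k' ∧ ρ.bind k ⊗ₘ k' = (ρ ⊗ₘ k).map Prod.swap := by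
    intro ρ _ k hk
    refine ⟨((ρ ⊗ₘ k).map Prod.swap).condKernel, inferInstance, ?_⟩
    have h := ((ρ ⊗ₘ k).map Prod.swap).disintegrate ((ρ ⊗ₘ k).map Prod.swap).condKernel
    rwa [Measure.fst_map_swap, Measure.snd_compProd] at h
  let S := {k : Kernel E E // IsMarkovKernel k}
  have hstep : ∀ (n : ℕ) (k : S), ∃ k' : S,
      (if Even n then η.bind k.1 else μ.bind k.1) ⊗ₘ k'.1
        = ((if Even n then η else μ) ⊗ₘ k.1).map Prod.swap := by
    intro n k
    by_cases hn : Even n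
    · obtain ⟨k', h1, h2⟩ := step η k.1 k.2
      exact ⟨⟨k', h1⟩, by simpa [hn] using h2⟩
    · obtain ⟨k', h1, h2⟩ := step μ k.1 k.2
      exact ⟨⟨k', h1⟩, by simpa [hn] using h2⟩
  choose F hF using hstep
  let K : ℕ → S := fun n => Nat.rec ⟨K₀, inferInstance⟩ F n
  refine ⟨fun n => (K n).1, rfl, fun n => (K n).2, fun n => ?_, fun n => ?_⟩
  · have h := hF (2 * n) (K (2 * n))
    have he : Even (2 * n) := even_two_mul n
    simp only [he, if_true] at h
    simp only [sinkhornMarginal, he, if_true]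
    change (_ ⊗ₘ (F (2 * n) (K (2 * n))).1).map Prod.swap = _
    rw [h, Measure.map_map measurable_swap measurable_swap]
    simp
  · have h := hF (2 * n + 1) (K (2 * n + 1))
    have he : ¬ Even (2 * n + 1) := by simp
    simp only [he, if_false] at h
    simp only [sinkhornMarginal, he, if_false]
    exact h

end

/-! Let `P` have marginals `η` and `μ`. Conditioning a Sinkhorn bridge on one coordinate and
correcting that marginal lowers the entropy of `P` relative to the bridge by exactly the entropy of
the target marginal relative to the current one: this is the chain rule (`klDiv_even_eq_add`,
`klDiv_odd_eq_add`). Telescoping bounds each series of marginal entropies by `klDiv P (η ⊗ₘ K 0)`.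
Each series is also antitone, by data processing, so its terms are at most the total over `n`, and
`o(1 / n)` when the total is finite. -/

section Sequences

/-- Over a horizon `n + 1`, an antitone sequence is at most the average of its values. -/
lemma Antitone.natCast_succ_mul_le_sum_range {a : ℕ → ℝ≥0∞} (ha : Antitone a) (n : ℕ) :
    ((n + 1 : ℕ) : ℝ≥0∞) * a n ≤ ∑ k ∈ Finset.range (n + 1), a k := by
  have h := Finset.card_nsmul_le_sum (Finset.range (n + 1)) a (a n)
    fun k hk => ha (Nat.lt_succ_iff.mp (Finset.mem_range.mp hk))
  simpa using h

lemma Antitone.le_one_div_mul_of_tsum_le {a : ℕ → ℝ≥0∞} (ha : Antitone a) {c : ℝ≥0∞}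
    (hc : ∑' k, a k ≤ c) {n : ℕ} (hn : 1 ≤ n) : a n ≤ (1 / (n : ℝ≥0∞)) * c := by
  have hn0 : (n : ℝ≥0∞) ≠ 0 := by exact_mod_cast (by lia : n ≠ 0)
  rw [one_div, mul_comm, ← div_eq_mul_inv,
    ENNReal.le_div_iff_mul_le (Or.inl hn0) (Or.inl (ENNReal.natCast_ne_top n)), mul_comm]
  calc (n : ℝ≥0∞) * a n ≤ ((n + 1 : ℕ) : ℝ≥0∞) * a n := by gcongr; lia
    _ ≤ ∑ k ∈ Finset.range (n + 1), a k := ha.natCast_succ_mul_le_sum_range n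
    _ ≤ ∑' k, a k := ENNReal.sum_le_tsum _
    _ ≤ c := hc

/-- The terms of a summable antitone sequence are `o(1 / n)`. -/
lemma Antitone.tendsto_natCast_mul_of_tsum_ne_top {a : ℕ → ℝ≥0∞} (ha : Antitone a)
    (hs : ∑' k, a k ≠ ∞) : Tendsto (fun n : ℕ => (n : ℝ≥0∞) * a n) atTop (𝓝 0) := by
  -- The indices from `n / 2` to `n` make up at least half of `n` terms, each at least `a n`, so
  -- twice the tail from `n / 2` dominates `n * a n`.
  have hlim : Tendsto (fun n : ℕ => 2 * ∑' k, a (k + n / 2)) atTop (𝓝 0) := by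
    have h := ENNReal.Tendsto.const_mul (a := 2) ((ENNReal.tendsto_sum_nat_add a hs).comp
      (Nat.tendsto_div_const_atTop (n := 2) two_ne_zero)) (Or.inr ENNReal.ofNat_ne_top)
    simpa using h
  refine tendsto_of_tendsto_of_tendsto_of_le_of_le tendsto_const_nhds hlim
    (fun _ => zero_le) fun n => ?_
  have hshift : Antitone fun k => a (k + n / 2) := fun i j hij => ha (by lia)
  calc (n : ℝ≥0∞) * a n ≤ ((2 * (n - n / 2 + 1) : ℕ) : ℝ≥0∞) * a (n - n / 2 + n / 2) := by
        rw [Nat.sub_add_cancel (Nat.div_le_self n 2)]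
        gcongr
        lia
    _ = 2 * (((n - n / 2 + 1 : ℕ) : ℝ≥0∞) * a (n - n / 2 + n / 2)) := by push_cast; ring
    _ ≤ 2 * ∑' k, a (k + n / 2) := by
        gcongr
        exact (hshift.natCast_succ_mul_le_sum_range _).trans (ENNReal.sum_le_tsum _)

/-- A telescoping bound: the increments of an `ℝ≥0∞`-valued sequence dominate the sum. -/
lemma tsum_le_of_add_le {a b : ℕ → ℝ≥0∞} (h : ∀ n, a n + b (n + 1) ≤ b n) :
    ∑' n, a n ≤ b 0 := by
  have hpart : ∀ n, ∑ k ∈ Finset.range n, a k + b n ≤ b 0 := by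
    intro n
    induction n with
    | zero => simp
    | succ n ih =>
      rw [Finset.sum_range_succ, add_assoc]
      exact (add_le_add_right (h n) _).trans ih
  rw [ENNReal.tsum_eq_iSup_nat]
  exact iSup_le fun n => le_self_add.trans (hpart n)

end Sequences

section Entropy

variable {E F : Type*} [MeasurableSpace E] [MeasurableSpace F]

lemma klDiv_map_swap (P Q : Measure (E × F)) [IsFiniteMeasure P] [IsFiniteMeasure Q] :
    klDiv (P.map Prod.swap) (Q.map Prod.swap) = klDiv P Q := by
  refine le_antisymm (klDiv_map_le P Q measurable_swap) ?_
  have h := klDiv_map_le (P.map Prod.swap) (Q.map Prod.swap) measurable_swap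
  simpa [Measure.map_map measurable_swap measurable_swap] using h

/-- The entropy of a measure with respect to `ν ⊗ₘ κ` splits into the entropy of its first
marginal and the entropy with respect to the measure with corrected first marginal. -/
lemma klDiv_compProd_eq_klDiv_fst_add [StandardBorelSpace F] [Nonempty F] (P : Measure (E × F))
    [IsFiniteMeasure P] (ν : Measure E) [IsFiniteMeasure ν] (κ : Kernel E F) [IsMarkovKernel κ] :
    klDiv P (ν ⊗ₘ κ) = klDiv P.fst ν + klDiv P (P.fst ⊗ₘ κ) := by
  -- Chain rule for the disintegration of `P` along its first coordinate.
  have h := klDiv_compProd_eq_add P.fst ν P.condKernel κ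
  rwa [P.disintegrate P.condKernel] at h

end Entropy

namespace IsSinkhorn

variable {E : Type*} [MeasurableSpace E] {η μ : Measure E} {K : ℕ → Kernel E E}

lemma sinkhornMarginal_even (n : ℕ) : sinkhornMarginal η μ K (2 * n) = η.bind (K (2 * n)) := by
  simp [sinkhornMarginal]

lemma sinkhornMarginal_odd (n : ℕ) :
    sinkhornMarginal η μ K (2 * n + 1) = μ.bind (K (2 * n + 1)) := by
  simp [sinkhornMarginal]

variable [IsProbabilityMeasure η] [IsProbabilityMeasure μ]

lemma isProbabilityMeasure_sinkhornMarginal (hK : IsSinkhorn η μ K) (n : ℕ) :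
    IsProbabilityMeasure (sinkhornMarginal η μ K n) := by
  have := hK.markov n
  unfold sinkhornMarginal
  split_ifs <;> infer_instance

/-- Every odd transition sends the preceding marginal to `η`. -/
lemma bind_odd (hK : IsSinkhorn η μ K) (n : ℕ) :
    (sinkhornMarginal η μ K (2 * n)).bind (K (2 * n + 1)) = η := by
  have := hK.markov
  have := hK.isProbabilityMeasure_sinkhornMarginal
  have h := congrArg Measure.fst (hK.odd_step n)
  rwa [Measure.fst_map_swap, Measure.snd_compProd, Measure.fst_compProd] at h

/-- Every even transition sends the preceding marginal to `μ`. -/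
lemma bind_even (hK : IsSinkhorn η μ K) (n : ℕ) :
    (sinkhornMarginal η μ K (2 * n + 1)).bind (K (2 * (n + 1))) = μ := by
  have := hK.markov
  have := hK.isProbabilityMeasure_sinkhornMarginal
  have h := congrArg Measure.snd (hK.even_step n)
  rwa [Measure.snd_map_swap, Measure.snd_compProd, Measure.fst_compProd] at h

/-- Data processing twice: `K (2n+1)` sends the pair `(μ, π_{2n})` to `(π_{2n+1}, η)`, which `K
(2n+2)` sends to `(μ, π_{2n+2})`. -/
lemma antitone_klDiv_even (hK : IsSinkhorn η μ K) :
    Antitone fun n => klDiv μ (sinkhornMarginal η μ K (2 * n)) := by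
  have := hK.markov
  have := hK.isProbabilityMeasure_sinkhornMarginal
  refine antitone_nat_of_succ_le fun n => ?_
  calc klDiv μ (sinkhornMarginal η μ K (2 * (n + 1)))
      = klDiv ((sinkhornMarginal η μ K (2 * n + 1)).bind (K (2 * (n + 1))))
          (η.bind (K (2 * (n + 1)))) := by rw [hK.bind_even, sinkhornMarginal_even]
    _ ≤ klDiv (sinkhornMarginal η μ K (2 * n + 1)) η := klDiv_comp_right_le _ _ _
    _ = klDiv (μ.bind (K (2 * n + 1)))
          ((sinkhornMarginal η μ K (2 * n)).bind (K (2 * n + 1))) := by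
        rw [hK.bind_odd, sinkhornMarginal_odd]
    _ ≤ klDiv μ (sinkhornMarginal η μ K (2 * n)) := klDiv_comp_right_le _ _ _

lemma antitone_klDiv_odd (hK : IsSinkhorn η μ K) :
    Antitone fun n => klDiv η (sinkhornMarginal η μ K (2 * n + 1)) := by
  have := hK.markov
  have := hK.isProbabilityMeasure_sinkhornMarginal
  refine antitone_nat_of_succ_le fun n => ?_
  calc klDiv η (sinkhornMarginal η μ K (2 * (n + 1) + 1))
      = klDiv ((sinkhornMarginal η μ K (2 * (n + 1))).bind (K (2 * (n + 1) + 1)))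
          (μ.bind (K (2 * (n + 1) + 1))) := by rw [hK.bind_odd, sinkhornMarginal_odd]
    _ ≤ klDiv (sinkhornMarginal η μ K (2 * (n + 1))) μ := klDiv_comp_right_le _ _ _
    _ = klDiv (η.bind (K (2 * (n + 1))))
          ((sinkhornMarginal η μ K (2 * n + 1)).bind (K (2 * (n + 1)))) := by
        rw [hK.bind_even, sinkhornMarginal_even]
    _ ≤ klDiv η (sinkhornMarginal η μ K (2 * n + 1)) := klDiv_comp_right_le _ _ _

variable [StandardBorelSpace E] [Nonempty E] {P : Measure (E × E)} [IsProbabilityMeasure P]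

/-- Pythagorean identity for a step from an even to an odd Sinkhorn bridge. -/
lemma klDiv_even_eq_add (hK : IsSinkhorn η μ K) (hPY : P.snd = μ) (n : ℕ) :
    klDiv P (η ⊗ₘ K (2 * n)) = klDiv μ (sinkhornMarginal η μ K (2 * n)) +
      klDiv P ((μ ⊗ₘ K (2 * n + 1)).map Prod.swap) := by
  have := hK.markov
  have := hK.isProbabilityMeasure_sinkhornMarginal
  have hfst : (P.map Prod.swap).fst = μ := by rw [Measure.fst_map_swap, hPY]
  -- The coordinates are swapped so that the marginal to be split off, `μ`, comes first.
  have h := klDiv_compProd_eq_klDiv_fst_add (P.map Prod.swap)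
    (sinkhornMarginal η μ K (2 * n)) (K (2 * n + 1))
  have hswap : P = (P.map Prod.swap).map Prod.swap := by
    simp [Measure.map_map measurable_swap measurable_swap]
  rw [hfst] at h
  rw [← hK.odd_step n, hswap, klDiv_map_swap, klDiv_map_swap, h]

/-- Pythagorean identity for a step from an odd to an even Sinkhorn bridge. -/
lemma klDiv_odd_eq_add (hK : IsSinkhorn η μ K) (hPX : P.fst = η) (n : ℕ) :
    klDiv P ((μ ⊗ₘ K (2 * n + 1)).map Prod.swap) =
      klDiv η (sinkhornMarginal η μ K (2 * n + 1)) + klDiv P (η ⊗ₘ K (2 * (n + 1))) := by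
  have := hK.markov
  have := hK.isProbabilityMeasure_sinkhornMarginal
  rw [← hK.even_step n, klDiv_compProd_eq_klDiv_fst_add, hPX]

lemma tsum_klDiv_even_le (hK : IsSinkhorn η μ K) (hPX : P.fst = η) (hPY : P.snd = μ) :
    ∑' n, klDiv μ (sinkhornMarginal η μ K (2 * n)) ≤ klDiv P (η ⊗ₘ K 0) := by
  refine tsum_le_of_add_le (b := fun n => klDiv P (η ⊗ₘ K (2 * n))) fun n => ?_
  rw [hK.klDiv_even_eq_add hPY n, hK.klDiv_odd_eq_add hPX n]
  gcongr
  exact le_add_self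

lemma tsum_klDiv_odd_le (hK : IsSinkhorn η μ K) (hPX : P.fst = η) (hPY : P.snd = μ) :
    ∑' n, klDiv η (sinkhornMarginal η μ K (2 * n + 1)) ≤ klDiv P (η ⊗ₘ K 0) := by
  refine tsum_le_of_add_le (b := fun n => klDiv P (η ⊗ₘ K (2 * n))) fun n => ?_
  rw [hK.klDiv_even_eq_add hPY n, hK.klDiv_odd_eq_add hPX n]
  exact le_add_self

end IsSinkhorn

theorem theorem4 (d : ℕ) (η μ : Measure (EuclideanSpace ℝ (Fin d)))
    [IsProbabilityMeasure η] [IsProbabilityMeasure μ]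
    (K : ℕ → Kernel (EuclideanSpace ℝ (Fin d)) (EuclideanSpace ℝ (Fin d)))
    (hK : IsSinkhorn η μ K)
    (P : Measure (EuclideanSpace ℝ (Fin d) × EuclideanSpace ℝ (Fin d)))
    [IsProbabilityMeasure P] (hPX : P.fst = η) (hPY : P.snd = μ)
    (hP : klDiv P (η ⊗ₘ K 0) < ∞) :
    (∀ n : ℕ, 1 ≤ n →
      max (klDiv μ (sinkhornMarginal η μ K (2 * n)))
          (klDiv η (sinkhornMarginal η μ K (2 * n + 1)))
        ≤ (1 / (n : ℝ≥0∞)) * klDiv P (η ⊗ₘ K 0)) ∧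
    Tendsto (fun n : ℕ => (n : ℝ≥0∞) * klDiv μ (sinkhornMarginal η μ K (2 * n)))
      atTop (𝓝 0) ∧
    Tendsto (fun n : ℕ => (n : ℝ≥0∞) * klDiv η (sinkhornMarginal η μ K (2 * n + 1)))
      atTop (𝓝 0) := by
  have heven := hK.tsum_klDiv_even_le hPX hPY
  have hodd := hK.tsum_klDiv_odd_le hPX hPY
  exact ⟨fun n hn => max_le (hK.antitone_klDiv_even.le_one_div_mul_of_tsum_le heven hn)
      (hK.antitone_klDiv_odd.le_one_div_mul_of_tsum_le hodd hn),
    hK.antitone_klDiv_even.tendsto_natCast_mul_of_tsum_ne_top (heven.trans_lt hP).ne,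
    hK.antitone_klDiv_odd.tendsto_natCast_mul_of_tsum_ne_top (hodd.trans_lt hP).ne⟩
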